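/- Let $\Phi$ be a reduced, irreducible, finite, crystallographic root system spanning a Euclidean space $(V,(\cdot,\cdot))$, with simple roots $\alpha_1,\dots,\alpha_n$, positive roots $\Phi^+$, highest root $\theta$, coroots $\alpha^\vee=2\alpha/(\alpha,\alpha)$ and coroot lattice $Q^\vee=\mathbb Z\Phi^\vee$. Affine transformations of $V$ act on the right; so $xy$ means first $x$, then $y$. For $\lambda\in V$ let $t_\lambda$ be the translation $x\mapsto x+\lambda$, and for $\alpha\in\Phi$ let $s_\alpha$ be the orthogonal reflection $x\mapsto x-(x,\alpha)\alpha^\vee$. Let $W=\langle s_\alpha\mid\alpha\in\Phi\rangle$ and $W_a=W\ltimes Q^\vee$ (with $\lambda\in Q^\vee$ acting as $t_\lambda$), with distinguished generators $s_i=s_{\alpha_i}$ $(1\le i\le n)$ and $s_0=s_\theta t_{\theta^\vee}$. For $\alpha\in\Phi^+$ and $k\in\mathbb Z$ put $H_{\alpha,k}=\{x\mid(x,\alpha)=k\}$, $H^+_{\alpha,k}=\{x\mid(x,\alpha)>k\}$ and $H^-_{\alpha,k}=\{x\mid(x,\alpha)<k\}$. Let $A_0=\{x\in V\mid 0<(x,\alpha)<1\text{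 for all }\alpha\in\Phi^+\}$, and identify $w\in W_a$ with the alcove $A_0w$. Two alcoves $w,u\in W_a$ are adjacent if $u=s_iw$ for some $i\in\{0,\dots,n\}$. In this case exactly one hyperplane $H_{\alpha,k}$ separates them; the crossing $w\to u$ is positive, written $w\overset{+}{\leadsto}u$, if $A_0w\subset H_{\alpha,k}^-$ and $A_0u\subset H_{\alpha,k}^+$, and negative otherwise. Let $J\subseteq\{1,\dots,n\}$, $W_J=\langle s_j\mid j\in J\rangle$, $Q_J^\vee=\bigoplus_{j\in J}\mathbb Z\alpha_j^\vee$, $\widetilde W_J=W_J\ltimes Q_J^\vee$, and let $\Phi_J^+$ be the set of positive roots in the span of $\{\alpha_j\mid j\in J\}$. The fundamental $J$-alcove is $\mathcal A_J=\{x\in V\mid 0<(x,\alpha)<1\text{ for all }\alpha\in\Phi_J^+\}$; for $w\in W_a$ write $w\in\mathcal A_J$ if $A_0w\subset\mathcal A_J$. For $w\in\mathcal A_J$ and $\alpha\in Q^\vee$ with class $\bar\alpha\in Q^\vee/Q_J^\vee$, the pseudo-translate of $w$ by $\bar\alpha$ is $w\bullet t_{\bar\alpha}=wt_\alpha y$,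 where $y$ is the element of $\widetilde W_J$ such that $wt_\alpha y\in\mathcal A_J$. Statement. Let $w,u\in\mathcal A_J$ be adjacent alcoves and let $\alpha\in Q^\vee$. Then the pseudo-translates of $w$ and $u$ by $\bar\alpha$ are well defined (for each of $w$ and $u$ there is exactly one such element of $\widetilde W_J$), the alcoves $w\bullet t_{\bar\alpha}$ and $u\bullet t_{\bar\alpha}$ are again adjacent, and $$w\overset{+}{\leadsto}u\iff w\bullet t_{\bar\alpha}\overset{+}{\leadsto}u\bullet t_{\bar\alpha}.$$ -/

import Mathlib

open scoped InnerProductSpace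

noncomputable section

namespace AffineAlcoves

variable {ι V : Type*} [NormedAddCommGroup V] [InnerProductSpace ℝ V]

/-- The root pairing `P` of `V` with itself is a root system of the Euclidean space `V`: the pairing
is the inner product and the coroot of a root `α` is `2α/(α,α)`, so that `P.reflection i` is the
orthogonal reflection `x ↦ x - (x, α) α^∨` fixing the hyperplane orthogonal to `α`. -/
structure IsEuclidean (P : RootPairing ι ℝ V V) : Prop where
  pairing_eq : ∀ x y : V, P.toLinearMap x y = ⟪x, y⟫_ℝ
  coroot_eq : ∀ i, P.coroot i = (2 / ⟪P.root i, P.root i⟫_ℝ) • P.root i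

/-- The translation `t_v : x ↦ x + v`. -/
def transl (v : V) : V ≃ᵃ[ℝ] V := AffineEquiv.constVAdd ℝ V v

/-- The reflection `s_α = s_{α,0}` in the hyperplane orthogonal to the root `α`. -/
def rootRefl (P : RootPairing ι ℝ V V) (i : ι) : V ≃ᵃ[ℝ] V := (P.reflection i).toAffineEquiv

/-- The affine Weyl group `W_a = W ⋉ Q^∨`, where `W` is generated by all the reflections `s_α`
and `Q^∨` is the `ℤ`-span of the coroots.

Points are acted upon on the right, so the product `x y` (first `x`, then `y`) of two affine
transformations is `x.trans y`. -/
def affineWeylGroup (P : RootPairing ι ℝ V V) : Subgroup (V ≃ᵃ[ℝ] V) :=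
  Subgroup.closure
    ({g | ∃ i, g = rootRefl P i} ∪ {g | ∃ v ∈ P.corootSpan ℤ, g = transl v})

/-- The open half space `H_{α,k}^+ = {x | (x, α) > k}`. -/
def posHalf (P : RootPairing ι ℝ V V) (i : ι) (k : ℤ) : Set V := {x | (k : ℝ) < ⟪x, P.root i⟫_ℝ}

/-- The open half space `H_{α,k}^- = {x | (x, α) < k}`. -/
def negHalf (P : RootPairing ι ℝ V V) (i : ι) (k : ℤ) : Set V := {x | ⟪x, P.root i⟫_ℝ < (k : ℝ)}

section Base

variable {P : RootPairing ι ℝ V V} (b : P.Base)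

/-- The fundamental alcove `A_0`. -/
def fundAlcove : Set V :=
  {x | ∀ i, b.IsPos i → 0 < ⟪x, P.root i⟫_ℝ ∧ ⟪x, P.root i⟫_ℝ < 1}

/-- The alcove `A_0 w` attached to `w`. -/
def alcove (w : V ≃ᵃ[ℝ] V) : Set V := w '' fundAlcove b

/-- `i` is (the index of) the highest root `θ`: subtracting any root from `θ` leaves
a combination of simple roots with coefficients in `ℕ`. -/
def IsHighestRoot (i : ι) : Prop :=
  ∀ j, P.root i - P.root j ∈ AddSubmonoid.closure (P.root '' b.support)

/-- `s` is one of the distinguished generators `s_1, …, s_n` (the simple reflections) or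
`s_0 = s_θ t_{θ^∨}` of `W_a`. -/
def IsSimpleAffineReflection (s : V ≃ᵃ[ℝ] V) : Prop :=
  (∃ i ∈ b.support, s = rootRefl P i) ∨
    ∃ i, IsHighestRoot b i ∧ s = (rootRefl P i).trans (transl (P.coroot i))

/-- The alcoves `w` and `u` are adjacent: `u = s w` for some distinguished generator `s`. -/
def Adjacent (w u : V ≃ᵃ[ℝ] V) : Prop :=
  ∃ s, IsSimpleAffineReflection b s ∧ u = s.trans w

/-- `w ⇝⁺ u`: the alcoves `w` and `u` are adjacent and the hyperplane `H_{α,k}` (`α` positive)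
separating them has `w` on its negative side and `u` on its positive side. -/
def PositiveCrossing (w u : V ≃ᵃ[ℝ] V) : Prop :=
  Adjacent b w u ∧
    ∃ i, b.IsPos i ∧ ∃ k : ℤ, alcove b w ⊆ negHalf P i k ∧ alcove b u ⊆ posHalf P i k

variable (J : Set b.support)

/-- The lattice `Q_J^∨` spanned by the simple coroots indexed by `J`. -/
def corootLatticeJ : Submodule ℤ V :=
  Submodule.span ℤ ((fun j : b.support => P.coroot j) '' J)

/-- The group `W_J ⋉ Q_J^∨`, where `W_J` is generated by the `s_j` with `j ∈ J`. -/
def affineWeylGroupJ : Subgroup (V ≃ᵃ[ℝ] V) :=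
  Subgroup.closure
    ({g | ∃ j ∈ J, g = rootRefl P j} ∪ {g | ∃ v ∈ corootLatticeJ b J, g = transl v})

/-- `i` indexes a positive root of `Φ_J`, the root subsystem generated by the simple roots
in `J`. -/
def IsPosJ (i : ι) : Prop :=
  b.IsPos i ∧ P.root i ∈ Submodule.span ℝ ((fun j : b.support => P.root j) '' J)

/-- The fundamental `J`-alcove `𝒜_J`. -/
def fundAlcoveJ : Set V :=
  {x | ∀ i, IsPosJ b J i → 0 < ⟪x, P.root i⟫_ℝ ∧ ⟪x, P.root i⟫_ℝ < 1}

/-- `w ∈ 𝒜_J`: the alcove `A_0 w` lies in the fundamental `J`-alcove. -/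
def MemJ (w : V ≃ᵃ[ℝ] V) : Prop := alcove b w ⊆ fundAlcoveJ b J

/-- `p_J(x)`: the element `x y` with `y ∈ W_J ⋉ Q_J^∨` that lies in `𝒜_J` (there is exactly one
such `y` for `x ∈ W_a`). -/
def projJ (x : V ≃ᵃ[ℝ] V) : V ≃ᵃ[ℝ] V :=
  Classical.epsilon fun z => (∃ y ∈ affineWeylGroupJ b J, z = x.trans y) ∧ MemJ b J z

/-- The quotient `Q^∨ / Q_J^∨`. -/
abbrev CorootQuot : Type _ :=
  P.corootSpan ℤ ⧸ (corootLatticeJ b J).submoduleOf (P.corootSpan ℤ)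

theorem projJ_transl_eq (x : V ≃ᵃ[ℝ] V) {v v' : V} (h : v - v' ∈ corootLatticeJ b J) :
    projJ b J (x.trans (transl v)) = projJ b J (x.trans (transl v')) := by
  have key : ∀ {v v' : V}, v - v' ∈ corootLatticeJ b J → ∀ z : V ≃ᵃ[ℝ] V,
      (∃ y ∈ affineWeylGroupJ b J, z = (x.trans (transl v)).trans y) →
      (∃ y ∈ affineWeylGroupJ b J, z = (x.trans (transl v')).trans y) := by
    rintro v v' h z ⟨y, hy, rfl⟩
    refine ⟨(transl (v - v')).trans y, ?_, ?_⟩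
    · exact mul_mem hy (Subgroup.subset_closure (Or.inr ⟨_, h, rfl⟩))
    · ext p
      simp [transl]
      abel
  have h' : v' - v ∈ corootLatticeJ b J := by
    rw [← neg_sub]; exact neg_mem h
  unfold projJ
  congr 1
  funext z
  exact propext ⟨fun hz => ⟨key h z hz.1, hz.2⟩, fun hz => ⟨key h' z hz.1, hz.2⟩⟩

/-- The pseudo-translation `w • t_ᾱ = p_J(w t_α)`, for a class `ᾱ ∈ Q^∨ / Q_J^∨`. -/
def pseudoTranslate (w : V ≃ᵃ[ℝ] V) (c : CorootQuot b J) : V ≃ᵃ[ℝ] V :=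
  Quotient.liftOn' c (fun α : P.corootSpan ℤ => projJ b J (w.trans (transl (α : V))))
    (fun _ _ h => projJ_transl_eq b J w ((Submodule.quotientRel_def _).mp h :))

end Base

end AffineAlcoves

end

open scoped InnerProductSpace

noncomputable section

namespace AffineAlcoves

variable {ι V : Type*} [NormedAddCommGroup V] [InnerProductSpace ℝ V]

/-! ### Reflections, translations and integrality in the Euclidean setting -/

section Euclidean

variable {P : RootPairing ι ℝ V V}

/-! One affine map `g`, namely translation by `α` followed by a suitable `y` in `W_J ⋉ Q_J^∨`,
serves both alcoves. Adjacency survives because the distinguished generator acts first and `g` last.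
Both `Q^∨` and `W_J ⋉ Q_J^∨` lie in `parabolicGroup`: a simple reflection from `J` permutes the
positive roots outside `Φ_J`, and translations change no root. A hyperplane separating two alcoves
of `𝒜_J` cannot come from `Φ_J`, since no such hyperplane meets `𝒜_J`; so `g` keeps its orientation
(`positiveCrossing_trans`), and the converse uses `g⁻¹`.

Existence of `y` (`exists_mem_fundAlcoveJ`): a point of the orbit that is nearly closest to a given
point of `𝒜_J` must lie in `𝒜_J`, as otherwise a reflection would bring it substantially closer.

Uniqueness (`eq_one_of_mem_fundAlcoveJ`): if an element of `W_J ⋉ Q_J^∨` maps a point of `𝒜_J` into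
`𝒜_J`, its translation part is in `Q_J^∨` and pairs to at most 1 with every root of `Φ_J`, hence
vanishes (`sum_coroot_eq_zero`). The linear part then preserves positivity of roots, and the
exchange condition makes it trivial (`wordProd_eq_one`). -/

lemma inner_root_pos (i : ι) : 0 < ⟪P.root i, P.root i⟫_ℝ :=
  real_inner_self_pos.2 (P.ne_zero i)

lemma IsEuclidean.reflection_apply (hP : IsEuclidean P) (i : ι) (x : V) :
    P.reflection i x = x - ⟪x, P.root i⟫_ℝ • P.coroot i := by
  rw [P.reflection_apply, LinearMap.flip_apply, hP.pairing_eq, hP.coroot_eq,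
    inner_smul_right, smul_smul, mul_comm]

lemma IsEuclidean.inner_coroot (hP : IsEuclidean P) (i j : ι) :
    ⟪P.coroot i, P.root j⟫_ℝ = P.pairing j i := by
  rw [← P.root_coroot_eq_pairing, hP.pairing_eq, real_inner_comm]

lemma IsEuclidean.inner_coroot_self (hP : IsEuclidean P) (i : ι) :
    ⟪P.coroot i, P.root i⟫_ℝ = 2 := by
  rw [hP.inner_coroot, P.pairing_same]

lemma IsEuclidean.exists_int_inner_coroot [P.IsCrystallographic] (hP : IsEuclidean P) (i j : ι) :
    ∃ n : ℤ, ⟪P.coroot i, P.root j⟫_ℝ = n :=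
  ⟨P.pairingIn ℤ j i, by rw [hP.inner_coroot, ← P.algebraMap_pairingIn ℤ]; simp⟩

lemma IsEuclidean.inner_reflection (hP : IsEuclidean P) (i : ι) (x y : V) :
    ⟪P.reflection i x, P.reflection i y⟫_ℝ = ⟪x, y⟫_ℝ := by
  have h := (inner_root_pos (P := P) i).ne'
  simp only [hP.reflection_apply, hP.coroot_eq, inner_sub_left, inner_sub_right, inner_smul_left,
    inner_smul_right, real_inner_comm y (P.root i)]
  simp only [conj_trivial]
  field_simp
  ring

lemma IsEuclidean.reflection_conj (hP : IsEuclidean P) {g : V ≃ₗ[ℝ] V}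
    (hg : ∀ x y, ⟪g x, g y⟫_ℝ = ⟪x, y⟫_ℝ) {i j : ι} (hij : g (P.root j) = P.root i) :
    P.reflection i * g = g * P.reflection j := by
  ext x
  simp only [LinearEquiv.mul_apply, hP.reflection_apply, hP.coroot_eq, map_sub, map_smul, ← hij, hg]

lemma IsEuclidean.exists_int_inner [P.IsCrystallographic] (hP : IsEuclidean P) {v : V}
    (hv : v ∈ P.corootSpan ℤ) (i : ι) : ∃ n : ℤ, ⟪v, P.root i⟫_ℝ = n := by
  induction hv using Submodule.span_induction with
  | mem x hx =>
    obtain ⟨j, rfl⟩ := hx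
    exact hP.exists_int_inner_coroot j i
  | zero => exact ⟨0, by simp⟩
  | add x y _ _ hx hy =>
    obtain ⟨m, hm⟩ := hx
    obtain ⟨n, hn⟩ := hy
    exact ⟨m + n, by rw [inner_add_left, hm, hn]; push_cast; rfl⟩
  | smul a x _ hx =>
    obtain ⟨m, hm⟩ := hx
    exact ⟨a * m, by
      rw [← Int.cast_smul_eq_zsmul ℝ, real_inner_smul_left, hm]; push_cast; rfl⟩

lemma transl_apply (v x : V) : transl v x = x + v := by
  simp [transl, add_comm]

lemma rootRefl_apply (i : ι) (x : V) : rootRefl P i x = P.reflection i x := rfl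

lemma root_reflectionPerm_self (i : ι) : P.root (P.reflectionPerm i i) = -P.root i := by
  rw [P.root_reflectionPerm, P.reflection_apply_self]

end Euclidean

/-! ### Positive roots, the subsystem `Φ_J` and the fundamental alcove -/

section Base

variable {P : RootPairing ι ℝ V V} (b : P.Base) (J : Set b.support)

/-- The span of the simple roots indexed by `J`. -/
abbrev rootSpanJ : Submodule ℝ V := Submodule.span ℝ ((fun j : b.support => P.root j) '' J)

variable {b J}

lemma root_mem_rootSpanJ {j : b.support} (hj : j ∈ J) : P.root j ∈ rootSpanJ b J :=
  Submodule.subset_span ⟨j, hj, rfl⟩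

lemma coroot_mem_rootSpanJ_iff (hP : IsEuclidean P) {i : ι} :
    P.coroot i ∈ rootSpanJ b J ↔ P.root i ∈ rootSpanJ b J := by
  rw [hP.coroot_eq]
  exact Submodule.smul_mem_iff _ (div_ne_zero two_ne_zero (inner_root_pos i).ne')

lemma isPos_neg_iff {i : ι} : b.IsPos (P.reflectionPerm i i) ↔ ¬ b.IsPos i :=
  RootPairing.Base.IsPos.neg_iff_not b i

lemma corootLatticeJ_le_corootSpan : corootLatticeJ b J ≤ P.corootSpan ℤ := by
  refine Submodule.span_le.2 ?_
  rintro _ ⟨j, -, rfl⟩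
  exact Submodule.subset_span ⟨j, rfl⟩

lemma exists_nonneg_sum [P.IsRootSystem] {i : ι} (hi : b.IsPos i) (hJ : P.root i ∈ rootSpanJ b J) :
    ∃ c : b.support → ℝ, (∀ j, 0 ≤ c j) ∧ (∀ j, j ∉ J → c j = 0) ∧
      P.root i = ∑ j, c j • P.root j := by
  obtain ⟨f, -, hf, hfi⟩ := b.exists_root_eq_sum_int i
  have hf0 : 0 < f := by
    refine hf.resolve_right fun h => ?_
    have h1 : 0 < b.height i := hi
    rw [RootPairing.Base.height_eq_sum hfi] at h1
    exact h1.not_ge (Finset.sum_nonpos fun j _ => h.le j)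
  have hsum : P.root i = ∑ j : b.support, (f j : ℝ) • b.toWeightBasis j := by
    rw [hfi, ← Finset.sum_coe_sort]
    simp [Int.cast_smul_eq_zsmul]
  have hrepr : ∀ j, b.toWeightBasis.repr (P.root i) j = f j := by
    intro j
    rw [hsum]
    exact congrFun (b.toWeightBasis.repr_sum_self fun j => (f j : ℝ)) j
  refine ⟨fun j => f j, fun j => Int.cast_nonneg (hf0.le j), fun j hj => ?_, by simpa using hsum⟩
  have himg : (fun j : b.support => P.root j) '' J = b.toWeightBasis '' J := by
    simp [RootPairing.Base.toWeightBasis_apply]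
  rw [rootSpanJ, himg, Module.Basis.mem_span_image] at hJ
  by_contra h
  exact hj (hJ (by simpa [hrepr] using h))

/-- Expand one factor of `(α, α) > 0` in simple roots from `J`: the coefficients are nonnegative, so
some term is positive. -/
lemma exists_simple_inner_pos [P.IsRootSystem] {i : ι} (hi : b.IsPos i)
    (hJ : P.root i ∈ rootSpanJ b J) : ∃ j ∈ J, 0 < ⟪P.root i, P.root j⟫_ℝ := by
  obtain ⟨c, hc0, hcJ, hc⟩ := exists_nonneg_sum hi hJ
  by_contra! h
  refine (inner_root_pos (P := P) i).not_ge ?_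
  nth_rw 2 [hc]
  rw [inner_sum]
  refine Finset.sum_nonpos fun j _ => ?_
  rw [real_inner_smul_right]
  by_cases hj : j ∈ J
  · exact mul_nonpos_of_nonneg_of_nonpos (hc0 j) (h j hj)
  · simp [hcJ j hj]

lemma root_reflectionPerm_mem_iff (hP : IsEuclidean P) {j : b.support} (hj : j ∈ J) {i : ι} :
    P.root (P.reflectionPerm j i) ∈ rootSpanJ b J ↔ P.root i ∈ rootSpanJ b J := by
  rw [P.root_reflectionPerm, hP.reflection_apply]
  refine Submodule.sub_mem_iff_left _ (Submodule.smul_mem _ _ ?_)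
  exact (coroot_mem_rootSpanJ_iff hP).2 (root_mem_rootSpanJ hj)

lemma isPos_reflectionPerm_iff [Finite ι] [P.IsCrystallographic] [P.IsReduced]
    (hP : IsEuclidean P) {j : b.support} (hj : j ∈ J) {i : ι} (hi : P.root i ∉ rootSpanJ b J) :
    b.IsPos (P.reflectionPerm j i) ↔ b.IsPos i := by
  have key : ∀ {k : ι}, P.root k ∉ rootSpanJ b J → b.IsPos k → b.IsPos (P.reflectionPerm j k) :=
    fun {k} hk hp => hp.reflectionPerm j.2 (by rintro rfl; exact hk (root_mem_rootSpanJ hj))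
  refine ⟨fun h => ?_, key hi⟩
  simpa using key (mt (root_reflectionPerm_mem_iff hP hj).1 hi) h

lemma rootRefl_reflectionPerm (i j : ι) :
    rootRefl P (P.reflectionPerm j i) = rootRefl P j * rootRefl P i * rootRefl P j := by
  ext x
  simp only [rootRefl_apply, P.reflection_reflectionPerm]
  rfl

lemma rootRefl_mem_of_mem {j : b.support} (hj : j ∈ J) : rootRefl P j ∈ affineWeylGroupJ b J :=
  Subgroup.subset_closure (Or.inl ⟨j, hj, rfl⟩)

lemma transl_mem {v : V} (hv : v ∈ corootLatticeJ b J) : transl v ∈ affineWeylGroupJ b J :=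
  Subgroup.subset_closure (Or.inr ⟨v, hv, rfl⟩)

/-- The reflections in the roots of `Φ_J` are generated by the simple ones, and
the coroots of `Φ_J` lie in the lattice `Q_J^∨`. -/
lemma rootRefl_mem_and_coroot_mem [Finite ι] [P.IsRootSystem] [P.IsCrystallographic] [P.IsReduced]
    (hP : IsEuclidean P) {i : ι} (hi : IsPosJ b J i) :
    rootRefl P i ∈ affineWeylGroupJ b J ∧ P.coroot i ∈ corootLatticeJ b J := by
  induction hn : (b.height i).toNat using Nat.strong_induction_on generalizing i with
  | _ n ih =>
    -- Reflecting in this `j` strictly lowers the height while staying positive and inside `Φ_J`,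
    -- which drives the induction.
    obtain ⟨j, hj, hji⟩ := exists_simple_inner_pos hi.1 hi.2
    obtain rfl | hne := eq_or_ne i j
    · exact ⟨rootRefl_mem_of_mem hj, Submodule.subset_span ⟨j, hj, rfl⟩⟩
    have hpos : b.IsPos (P.reflectionPerm j i) := hi.1.reflectionPerm j.2 hne
    have hroot : P.root (P.reflectionPerm j i) = P.root i + (-P.pairingIn ℤ i j) • P.root j := by
      rw [P.root_reflectionPerm, neg_smul, P.reflection_apply_root' ℤ, sub_eq_add_neg]
    have hpair : 0 < P.pairingIn ℤ i j := by
      have : (0 : ℝ) < P.pairingIn ℤ i j := by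
        have h := P.algebraMap_pairingIn ℤ i j
        rw [← hP.inner_coroot, hP.coroot_eq, real_inner_smul_left, real_inner_comm (P.root i)] at h
        have h' := mul_pos (div_pos two_pos (inner_root_pos (P := P) j)) hji
        rw [← h] at h'
        simpa using h'
      exact_mod_cast this
    have hht := b.height_add_zsmul hroot
    rw [RootPairing.Base.height_one_of_mem_support j.2] at hht
    have hi0 : 0 < b.height i := hi.1
    obtain ⟨h1, h2⟩ := ih (b.height (P.reflectionPerm j i)).toNat
      (by simp only [smul_eq_mul, mul_one] at hht; omega)
      (i := P.reflectionPerm j i) ⟨hpos, (root_reflectionPerm_mem_iff hP hj).2 hi.2⟩ rfl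
    have hii : i = P.reflectionPerm j (P.reflectionPerm j i) := by simp
    refine ⟨?_, ?_⟩
    · rw [hii, rootRefl_reflectionPerm]
      exact mul_mem (mul_mem (rootRefl_mem_of_mem hj) h1) (rootRefl_mem_of_mem hj)
    · rw [hii, P.coroot_reflectionPerm, P.coreflection_apply_coroot,
        ← P.algebraMap_pairingIn ℤ, algebraMap_smul]
      exact sub_mem h2 (Submodule.smul_mem _ _ (Submodule.subset_span ⟨j, hj, rfl⟩))

/-- The vector representing the height functional pairs with each positive root to a positive
integer; dividing by more than the largest height gives values in `(0, 1)`. -/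
lemma fundAlcove_nonempty [Finite ι] [P.IsRootSystem] : (fundAlcove b).Nonempty := by
  have : FiniteDimensional ℝ V := Module.Finite.of_basis b.toWeightBasis
  have : CompleteSpace V := FiniteDimensional.complete ℝ V
  let φ : V →L[ℝ] ℝ := LinearMap.toContinuousLinearMap (b.toWeightBasis.constr ℝ fun _ => (1 : ℝ))
  let x := (InnerProductSpace.toDual ℝ V).symm φ
  have hx : ∀ i, ⟪x, P.root i⟫_ℝ = b.height i := by
    intro i
    obtain ⟨f, -, -, hf⟩ := b.exists_root_eq_sum_int i
    have hsum : P.root i = ∑ j : b.support, f j • b.toWeightBasis j := by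
      rw [hf, ← Finset.sum_coe_sort]
      simp
    rw [RootPairing.Base.height_eq_sum hf, InnerProductSpace.toDual_symm_apply, hsum, map_sum,
      ← Finset.sum_coe_sort b.support f, Int.cast_sum]
    refine Finset.sum_congr rfl fun j _ => ?_
    rw [map_zsmul, LinearMap.coe_toContinuousLinearMap', Module.Basis.constr_basis]
    simp
  obtain ⟨N, hN⟩ := (Set.finite_range fun i => b.height i).bddAbove
  have hN' : ∀ i, b.height i ≤ N := fun i => hN ⟨i, rfl⟩
  refine ⟨((|N| + 1 : ℤ) : ℝ)⁻¹ • x, fun i hi => ?_⟩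
  have h0 : (0 : ℝ) < ((|N| + 1 : ℤ) : ℝ) := by positivity
  rw [real_inner_smul_left, hx]
  have hi0 : 0 < b.height i := hi
  refine ⟨mul_pos (inv_pos.2 h0) (by exact_mod_cast hi0), ?_⟩
  rw [inv_mul_lt_iff₀ h0, mul_one]
  have := hN' i
  have := le_abs_self N
  exact_mod_cast (by omega : b.height i < |N| + 1)

end Base

/-! ### Affine maps preserving positivity outside `Φ_J` -/

variable {P : RootPairing ι ℝ V V} {b : P.Base} {J : Set b.support}

/-- The group of affine transformations which permute the hyperplanes `H_{α,k}`, preserving `Φ_J`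
and the set of positive roots outside `Φ_J`. -/
def parabolicGroup (b : P.Base) (J : Set b.support) : Subgroup (V ≃ᵃ[ℝ] V) where
  carrier := {g | ∃ (σ : Equiv.Perm ι) (n : ι → ℤ), ∀ i,
    (∀ x, ⟪g x, P.root (σ i)⟫_ℝ = ⟪x, P.root i⟫_ℝ + n i) ∧
    (P.root (σ i) ∈ rootSpanJ b J ↔ P.root i ∈ rootSpanJ b J) ∧
    (P.root i ∉ rootSpanJ b J → (b.IsPos (σ i) ↔ b.IsPos i))}
  one_mem' := ⟨1, 0, fun i => by simp⟩
  mul_mem' := by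
    rintro g h ⟨σ, m, hg⟩ ⟨τ, n, hh⟩
    refine ⟨σ * τ, fun i => n i + m (τ i), fun i => ⟨fun x => ?_, ?_, fun hi => ?_⟩⟩
    · rw [Equiv.Perm.mul_apply, AffineEquiv.coe_mul, Function.comp_apply, (hg (τ i)).1, (hh i).1]
      push_cast
      ring
    · exact (hg (τ i)).2.1.trans (hh i).2.1
    · exact ((hg (τ i)).2.2 (mt (hh i).2.1.1 hi)).trans ((hh i).2.2 hi)
  inv_mem' := by
    rintro g ⟨σ, n, hg⟩
    refine ⟨σ.symm, fun i => -n (σ.symm i), fun i => ⟨fun x => ?_, ?_, fun hi => ?_⟩⟩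
    · have h := (hg (σ.symm i)).1 (g⁻¹ x)
      rw [σ.apply_symm_apply] at h
      have hx : g (g⁻¹ x) = x := g.apply_symm_apply x
      rw [hx] at h
      push_cast
      linarith
    · have h := (hg (σ.symm i)).2.1
      rw [σ.apply_symm_apply] at h
      exact h.symm
    · have h := (hg (σ.symm i)).2
      rw [σ.apply_symm_apply] at h
      exact (h.2 (mt h.1.2 hi)).symm

lemma transl_mem_parabolicGroup [P.IsCrystallographic] (hP : IsEuclidean P) {v : V}
    (hv : v ∈ P.corootSpan ℤ) : transl v ∈ parabolicGroup b J := by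
  choose n hn using hP.exists_int_inner hv
  exact ⟨1, n, fun i => by simp [transl_apply, inner_add_left, hn]⟩

lemma affineWeylGroupJ_le_parabolicGroup [Finite ι] [P.IsCrystallographic] [P.IsReduced]
    (hP : IsEuclidean P) : affineWeylGroupJ b J ≤ parabolicGroup b J := by
  refine (Subgroup.closure_le _).2 ?_
  rintro _ (⟨j, hj, rfl⟩ | ⟨v, hv, rfl⟩)
  · refine ⟨P.reflectionPerm j, 0, fun i => ⟨fun x => ?_, root_reflectionPerm_mem_iff hP hj,
      isPos_reflectionPerm_iff hP hj⟩⟩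
    rw [P.root_reflectionPerm, rootRefl_apply, hP.inner_reflection]
    simp
  · exact transl_mem_parabolicGroup hP (corootLatticeJ_le_corootSpan hv)

lemma isPosJ_or_isPosJ_neg {i : ι} (hi : P.root i ∈ rootSpanJ b J) :
    IsPosJ b J i ∨ IsPosJ b J (P.reflectionPerm i i) := by
  by_cases h : b.IsPos i
  · exact Or.inl ⟨h, hi⟩
  · refine Or.inr ⟨isPos_neg_iff.2 h, ?_⟩
    rw [root_reflectionPerm_self]
    exact neg_mem hi

lemma inner_mem_of_mem_fundAlcoveJ {x : V} (hx : x ∈ fundAlcoveJ b J) {i : ι}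
    (hi : P.root i ∈ rootSpanJ b J) (hneg : ¬ b.IsPos i) :
    -1 < ⟪x, P.root i⟫_ℝ ∧ ⟪x, P.root i⟫_ℝ < 0 := by
  have h := hx _ ((isPosJ_or_isPosJ_neg hi).resolve_left fun h => hneg h.1)
  rw [root_reflectionPerm_self, inner_neg_right] at h
  constructor <;> linarith [h.1, h.2]

/-- If `g` moves one point of `𝒜_J` into `𝒜_J`, then the offset of a hyperplane is determined. -/
lemma offset_eq {g : V ≃ᵃ[ℝ] V} {i k : ι} {n : ℤ}
    (hn : ∀ x, ⟪g x, P.root k⟫_ℝ = ⟪x, P.root i⟫_ℝ + n) (hi : P.root i ∈ rootSpanJ b J)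
    (hk : IsPosJ b J k) {x : V} (hx : x ∈ fundAlcoveJ b J) (hgx : g x ∈ fundAlcoveJ b J) :
    b.IsPos i ∧ n = 0 ∨ ¬ b.IsPos i ∧ n = 1 := by
  have h1 := hgx k hk
  rw [hn] at h1
  by_cases h : b.IsPos i
  · have h2 := hx i ⟨h, hi⟩
    have h3 : (-1 : ℝ) < n := by linarith
    have h4 : (n : ℝ) < 1 := by linarith
    norm_cast at h3 h4
    exact Or.inl ⟨h, by omega⟩
  · have h2 := inner_mem_of_mem_fundAlcoveJ hx hi h
    have h3 : (0 : ℝ) < n := by linarith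
    have h4 : (n : ℝ) < 2 := by linarith
    norm_cast at h3 h4
    exact Or.inr ⟨h, by omega⟩

/-- The single point `x` fixes every offset through `offset_eq`, and these offsets give the right
bounds at any other point of `𝒜_J`. -/
lemma mem_fundAlcoveJ_of_mem {g : V ≃ᵃ[ℝ] V} (hg : g ∈ parabolicGroup b J) {x x' : V}
    (hx : x ∈ fundAlcoveJ b J) (hgx : g x ∈ fundAlcoveJ b J) (hx' : x' ∈ fundAlcoveJ b J) :
    g x' ∈ fundAlcoveJ b J := by
  obtain ⟨σ, n, h⟩ := hg
  intro k hk
  obtain ⟨i, rfl⟩ := σ.surjective k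
  have hi := (h i).2.1.1 hk.2
  rw [(h i).1]
  rcases offset_eq (h i).1 hi hk hx hgx with ⟨hp, hn⟩ | ⟨hp, hn⟩
  · simpa [hn] using hx' i ⟨hp, hi⟩
  · have := inner_mem_of_mem_fundAlcoveJ hx' hi hp
    rw [hn, Int.cast_one]
    constructor <;> linarith [this.1, this.2]

lemma alcove_trans (w g : V ≃ᵃ[ℝ] V) : alcove b (w.trans g) = g '' alcove b w := by
  simp [alcove, Set.image_image]

lemma memJ_trans {w g : V ≃ᵃ[ℝ] V} (hg : g ∈ parabolicGroup b J) (hw : MemJ b J w) {x : V}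
    (hx : x ∈ fundAlcoveJ b J) (hgx : g x ∈ fundAlcoveJ b J) : MemJ b J (w.trans g) := by
  rw [MemJ, alcove_trans]
  rintro _ ⟨x', hx', rfl⟩
  exact mem_fundAlcoveJ_of_mem hg hx hgx (hw hx')

lemma adjacent_trans {w u : V ≃ᵃ[ℝ] V} (h : Adjacent b w u) (g : V ≃ᵃ[ℝ] V) :
    Adjacent b (w.trans g) (u.trans g) := by
  obtain ⟨s, hs, rfl⟩ := h
  exact ⟨s, hs, rfl⟩

lemma positiveCrossing_trans {w u g : V ≃ᵃ[ℝ] V} (h0 : (fundAlcove b).Nonempty)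
    (hg : g ∈ parabolicGroup b J) (hw : MemJ b J w) (hu : MemJ b J u)
    (h : PositiveCrossing b w u) : PositiveCrossing b (w.trans g) (u.trans g) := by
  obtain ⟨hadj, i, hi, k, hwk, huk⟩ := h
  obtain ⟨x, hx⟩ := h0
  -- Otherwise both alcoves lie strictly between levels 0 and 1 of this root, forcing an integer `0
  -- < k < 1`.
  have hiJ : P.root i ∉ rootSpanJ b J := by
    intro hiJ
    have hxw : w x ∈ alcove b w := ⟨x, hx, rfl⟩
    have hxu : u x ∈ alcove b u := ⟨x, hx, rfl⟩
    have h1 : ⟪w x, P.root i⟫_ℝ < k := hwk hxw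
    have h2 : (k : ℝ) < ⟪u x, P.root i⟫_ℝ := huk hxu
    have h3 : (0 : ℝ) < k := (hw hxw i ⟨hi, hiJ⟩).1.trans h1
    have h4 : (k : ℝ) < 1 := h2.trans (hu hxu i ⟨hi, hiJ⟩).2
    norm_cast at h3 h4
    omega
  obtain ⟨σ, n, hσ⟩ := hg
  refine ⟨adjacent_trans hadj g, σ i, ((hσ i).2.2 hiJ).2 hi, k + n i, ?_, ?_⟩
  · rw [alcove_trans]
    rintro _ ⟨y, hy, rfl⟩
    have h1 : ⟪y, P.root i⟫_ℝ < k := hwk hy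
    change ⟪g y, P.root (σ i)⟫_ℝ < _
    rw [(hσ i).1]
    push_cast
    linarith
  · rw [alcove_trans]
    rintro _ ⟨y, hy, rfl⟩
    have h1 : (k : ℝ) < ⟪y, P.root i⟫_ℝ := huk hy
    change _ < ⟪g y, P.root (σ i)⟫_ℝ
    rw [(hσ i).1]
    push_cast
    linarith

/-! ### Every generic point is moved into the fundamental `J`-alcove -/

lemma exists_pos_le_abs_sub_int {κ : Type*} [Finite κ] (a : κ → ℝ) (ha : ∀ i, ∀ n : ℤ, a i ≠ n) :
    ∃ ε > 0, ∀ i, ∀ n : ℤ, ε ≤ |a i - n| := by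
  have h : ∀ᶠ ε in nhdsWithin (0 : ℝ) (Set.Ioi 0), ∀ i, ε ≤ |a i - round (a i)| := by
    refine Filter.eventually_all.2 fun i => ?_
    have hi : 0 < |a i - round (a i)| := abs_pos.2 (sub_ne_zero.2 (ha i _))
    exact nhdsWithin_le_nhds (Iic_mem_nhds hi)
  obtain ⟨ε, hε, h0⟩ := (h.and self_mem_nhdsWithin).exists
  exact ⟨ε, h0, fun i n => (hε i).trans (round_le _ _)⟩

lemma ne_int_of_mem_fundAlcoveJ {x : V} (hx : x ∈ fundAlcoveJ b J) {i : ι}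
    (hi : P.root i ∈ rootSpanJ b J) (n : ℤ) : ⟪x, P.root i⟫_ℝ ≠ n := by
  intro h
  by_cases hp : b.IsPos i
  · have h1 := hx i ⟨hp, hi⟩
    rw [h] at h1
    norm_cast at h1
    omega
  · have h1 := inner_mem_of_mem_fundAlcoveJ hx hi hp
    rw [h] at h1
    norm_cast at h1
    omega

/-- The correction term is negative exactly when `H_{α,k}` strictly separates `x` from `p`, so
reflecting `x` then brings it closer to `p`. -/
lemma IsEuclidean.norm_sq_reflection_sub (hP : IsEuclidean P) (i : ι) (k : ℝ) (x p : V) :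
    ‖P.reflection i x + k • P.coroot i - p‖ ^ 2 = ‖x - p‖ ^ 2 +
      4 * (⟪x, P.root i⟫_ℝ - k) * (⟪p, P.root i⟫_ℝ - k) / ⟪P.root i, P.root i⟫_ℝ := by
  have h := (inner_root_pos (P := P) i).ne'
  have hv : P.reflection i x + k • P.coroot i - p =
      (x - p) - ((⟪x, P.root i⟫_ℝ - k) * (2 / ⟪P.root i, P.root i⟫_ℝ)) • P.root i := by
    rw [hP.reflection_apply, hP.coroot_eq]
    module
  rw [hv, norm_sub_sq_real, norm_smul, mul_pow, ← real_inner_self_eq_norm_sq (P.root i),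
    Real.norm_eq_abs, sq_abs, real_inner_smul_right, inner_sub_left]
  field_simp
  ring

lemma exists_mem_fundAlcoveJ [Finite ι] [P.IsRootSystem] [P.IsCrystallographic] [P.IsReduced]
    (hP : IsEuclidean P) {p x : V} (hp : p ∈ fundAlcoveJ b J)
    (hx : ∀ i, P.root i ∈ rootSpanJ b J → ∀ n : ℤ, ⟪x, P.root i⟫_ℝ ≠ n) :
    ∃ y ∈ affineWeylGroupJ b J, y x ∈ fundAlcoveJ b J := by
  let κ := {i // P.root i ∈ rootSpanJ b J}
  obtain ⟨ε, hε, hε'⟩ := exists_pos_le_abs_sub_int (fun i : κ => ⟪x, P.root i⟫_ℝ)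
    fun i n => hx i i.2 n
  obtain ⟨δ, hδ, hδ'⟩ := exists_pos_le_abs_sub_int (fun i : κ => ⟪p, P.root i⟫_ℝ)
    fun i n => ne_int_of_mem_fundAlcoveJ hp i.2 n
  obtain ⟨M, hM⟩ := (Set.finite_range fun i => ⟪P.root i, P.root i⟫_ℝ).bddAbove
  have hM' : ∀ i, ⟪P.root i, P.root i⟫_ℝ ≤ |M| := fun i => (hM ⟨i, rfl⟩).trans (le_abs_self M)
  let S : Set ℝ := (fun y : V ≃ᵃ[ℝ] V => ‖y x - p‖ ^ 2) '' affineWeylGroupJ b J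
  have hS : S.Nonempty := ⟨_, 1, one_mem _, rfl⟩
  have hSb : BddBelow S := ⟨0, by rintro _ ⟨y, -, rfl⟩; positivity⟩
  -- A lower bound for the decrease of squared distance under any separating reflection; coming this
  -- close to the infimum replaces attaining it.
  have hc : 0 < 4 * ε * δ / (|M| + 1) := by positivity
  obtain ⟨_, ⟨y, hy, rfl⟩, hlt⟩ := Real.lt_sInf_add_pos hS hc
  refine ⟨y, hy, ?_⟩
  have key : ∀ i, IsPosJ b J i → ∀ k : ℤ,
      ¬ (⟪y x, P.root i⟫_ℝ - k) * (⟪p, P.root i⟫_ℝ - k) ≤ 0 := by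
    intro i hi k hneg
    obtain ⟨hr, hq⟩ := rootRefl_mem_and_coroot_mem hP hi
    have hmem : transl (k • P.coroot i) * rootRefl P i * y ∈ affineWeylGroupJ b J :=
      mul_mem (mul_mem (transl_mem (Submodule.smul_mem _ _ hq)) hr) hy
    have hle := csInf_le hSb ⟨_, hmem, rfl⟩
    have happ : (transl (k • P.coroot i) * rootRefl P i * y) x =
        P.reflection i (y x) + (k : ℝ) • P.coroot i := by
      rw [Int.cast_smul_eq_zsmul]
      exact transl_apply _ _
    simp only [happ, hP.norm_sq_reflection_sub] at hle
    obtain ⟨σ, n, hσ⟩ := affineWeylGroupJ_le_parabolicGroup hP hy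
    -- The gap `ε` was chosen for `x`; it holds for `y x` because `y` permutes the roots of `Φ_J` up
    -- to integer offsets.
    have h1 : ε ≤ |⟪y x, P.root i⟫_ℝ - k| := by
      obtain ⟨j, rfl⟩ := σ.surjective i
      have := hε' ⟨j, (hσ j).2.1.1 hi.2⟩ (k - n j)
      rw [(hσ j).1]
      push_cast at this
      convert this using 2
      ring
    have h2 : δ ≤ |⟪p, P.root i⟫_ℝ - k| := hδ' ⟨i, hi.2⟩ k
    have h3 : ε * δ ≤ -((⟪y x, P.root i⟫_ℝ - k) * (⟪p, P.root i⟫_ℝ - k)) := by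
      rw [← abs_of_nonpos hneg, abs_mul]
      exact mul_le_mul h1 h2 hδ.le (abs_nonneg _)
    have h4 : 4 * ε * δ / (|M| + 1) ≤
        -(4 * (⟪y x, P.root i⟫_ℝ - k) * (⟪p, P.root i⟫_ℝ - k)) / ⟪P.root i, P.root i⟫_ℝ :=
      div_le_div₀ (by nlinarith [mul_pos hε hδ]) (by linarith) (inner_root_pos i)
        (by linarith [hM' i])
    rw [neg_div] at h4
    linarith
  intro i hi
  have hp' := hp i hi
  refine ⟨?_, ?_⟩
  · by_contra h
    refine key i hi 0 (mul_nonpos_of_nonpos_of_nonneg ?_ ?_) <;> push_cast <;> linarith [hp'.1]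
  · by_contra h
    refine key i hi 1 (mul_nonpos_of_nonneg_of_nonpos ?_ ?_) <;> push_cast <;> linarith [hp'.2]

/-! ### Words in the simple reflections -/

/-- The product of the simple reflections in a list. -/
def wordProd (b : P.Base) (l : List b.support) : V ≃ₗ[ℝ] V :=
  (l.map fun i : b.support => P.reflection i).prod

@[simp] lemma wordProd_nil : wordProd b [] = 1 := rfl

@[simp] lemma wordProd_cons (i : b.support) (l : List b.support) :
    wordProd b (i :: l) = P.reflection i * wordProd b l := by
  simp [wordProd]

@[simp] lemma wordProd_append (l l' : List b.support) :
    wordProd b (l ++ l') = wordProd b l * wordProd b l' := by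
  simp [wordProd]

lemma wordProd_inv (l : List b.support) : (wordProd b l)⁻¹ = wordProd b l.reverse := by
  simp [wordProd, List.prod_inv_reverse, List.map_reverse, Function.comp_def]

lemma IsEuclidean.inner_wordProd (hP : IsEuclidean P) (l : List b.support) (x y : V) :
    ⟪wordProd b l x, wordProd b l y⟫_ℝ = ⟪x, y⟫_ℝ := by
  induction l with
  | nil => rfl
  | cons i l ih => rw [wordProd_cons, LinearEquiv.mul_apply, LinearEquiv.mul_apply,
      hP.inner_reflection, ih]

lemma exists_root_eq_wordProd (l : List b.support) (i : ι) :
    ∃ k, P.root k = wordProd b l (P.root i) := by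
  induction l with
  | nil => exact ⟨i, rfl⟩
  | cons j l ih =>
    obtain ⟨k, hk⟩ := ih
    exact ⟨P.reflectionPerm j k, by rw [P.root_reflectionPerm, hk, wordProd_cons]; rfl⟩

/-- The exchange condition. -/
lemma exists_wordProd_eq_mul_reflection [Finite ι] [P.IsCrystallographic] [P.IsReduced]
    (hP : IsEuclidean P) (l : List b.support) (j : b.support) {k : ι}
    (hk : P.root k = wordProd b l (P.root j)) (hneg : ¬ b.IsPos k) :
    ∃ l' : List b.support, wordProd b l * P.reflection j = wordProd b l' ∧
      l'.length + 1 = l.length := by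
  induction l generalizing k with
  | nil =>
    have hkj : k = j := P.root.injective hk
    exact absurd (RootPairing.Base.isPos_of_mem_support j.2) (hkj ▸ hneg)
  | cons i l ih =>
    obtain ⟨m, hm⟩ := exists_root_eq_wordProd l (j : ι)
    -- If the tail keeps `α_j` positive, the letter `i` makes it negative, so the tail sends `α_j`
    -- to `α_i` and conjugation deletes `i`. Otherwise a letter is deleted from the tail.
    by_cases hmp : b.IsPos m
    · have hkm : k = P.reflectionPerm i m := P.root.injective <| by
        rw [P.root_reflectionPerm, hm, hk, wordProd_cons]
        rfl
      have hmi : m = i := by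
        by_contra h
        exact hneg (hkm ▸ hmp.reflectionPerm i.2 h)
      refine ⟨l, ?_, rfl⟩
      rw [hmi] at hm
      rw [wordProd_cons, hP.reflection_conj (hP.inner_wordProd l) hm.symm, mul_assoc, ← sq,
        P.reflection_sq, mul_one]
    · obtain ⟨l', hl', hlen⟩ := ih hm hmp
      exact ⟨i :: l', by rw [wordProd_cons, mul_assoc, hl', wordProd_cons], by simp [hlen]⟩

/-- An element of the Weyl group which maps all simple roots to positive roots is trivial. -/
lemma wordProd_eq_one [Finite ι] [P.IsCrystallographic] [P.IsReduced]
    (hP : IsEuclidean P) (l : List b.support)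
    (hl : ∀ (j : b.support) (k : ι), P.root k = wordProd b l (P.root j) → b.IsPos k) :
    wordProd b l = 1 := by
  induction hn : l.length using Nat.strong_induction_on generalizing l with
  | _ n ih =>
    obtain rfl | ⟨l, j, rfl⟩ := l.eq_nil_or_concat
    · rfl
    obtain ⟨m, hm⟩ := exists_root_eq_wordProd l (j : ι)
    -- The last letter negates `α_j`, so the rest of the word must send `α_j` to a negative root;
    -- exchange then shortens the whole word by two letters.
    have hpos : b.IsPos (P.reflectionPerm m m) := hl j _ <| by
      rw [root_reflectionPerm_self, hm, List.concat_eq_append, wordProd_append]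
      simp
    obtain ⟨l', hl', hlen⟩ := exists_wordProd_eq_mul_reflection hP l j hm (isPos_neg_iff.1 hpos)
    have heq : wordProd b (l.concat j) = wordProd b l' := by
      rw [List.concat_eq_append, wordProd_append, ← hl']
      simp
    rw [heq]
    refine ih l'.length ?_ l' (by rwa [heq] at hl) rfl
    rw [List.length_concat] at hn
    omega

lemma exists_linear_eq_wordProd {g : V ≃ᵃ[ℝ] V} (hg : g ∈ affineWeylGroupJ b J) :
    ∃ l, g.linear = wordProd b l := by
  induction hg using Subgroup.closure_induction with
  | mem x hx =>
    rcases hx with ⟨j, -, rfl⟩ | ⟨v, -, rfl⟩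
    · exact ⟨[j], by simp; rfl⟩
    · exact ⟨[], rfl⟩
  | one => exact ⟨[], rfl⟩
  | mul x y _ _ hx hy =>
    obtain ⟨l, hl⟩ := hx
    obtain ⟨l', hl'⟩ := hy
    exact ⟨l ++ l', by rw [wordProd_append, ← hl, ← hl']; rfl⟩
  | inv x _ hx =>
    obtain ⟨l, hl⟩ := hx
    exact ⟨l.reverse, by rw [← wordProd_inv, ← hl]; rfl⟩

/-! ### Fixed alcoves -/

lemma apply_mem_corootLatticeJ_iff [P.IsCrystallographic] (hP : IsEuclidean P) {g : V ≃ᵃ[ℝ] V}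
    (hg : g ∈ affineWeylGroupJ b J) (v : V) :
    g v ∈ corootLatticeJ b J ↔ v ∈ corootLatticeJ b J := by
  induction hg using Subgroup.closure_induction generalizing v with
  | mem x hx =>
    rcases hx with ⟨j, hj, rfl⟩ | ⟨q, hq, rfl⟩
    · have key : ∀ {v}, v ∈ corootLatticeJ b J → P.reflection j v ∈ corootLatticeJ b J := by
        intro v hv
        obtain ⟨n, hn⟩ := hP.exists_int_inner (corootLatticeJ_le_corootSpan hv) j
        rw [hP.reflection_apply, hn, Int.cast_smul_eq_zsmul]
        exact sub_mem hv (Submodule.smul_mem _ _ (Submodule.subset_span ⟨j, hj, rfl⟩))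
      exact ⟨fun h => by simpa [rootRefl_apply] using key h, key⟩
    · rw [transl_apply]
      exact Submodule.add_mem_iff_left _ hq
  | one => rfl
  | mul x y _ _ hx hy => exact (hx (y v)).trans (hy v)
  | inv x _ hx =>
    rw [← hx]
    exact iff_of_eq (congrArg (· ∈ _) (x.apply_symm_apply v))

/-- In the dual system `P.flip`, two roots at an obtuse angle that are not opposite add up to a
root. -/
lemma exists_coroot_add_eq [Finite ι] [P.IsCrystallographic] (hP : IsEuclidean P) {i j : ι}
    (h : ⟪P.coroot j, P.root i⟫_ℝ < 0) (hne : P.coroot i ≠ -P.coroot j) :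
    ∃ k, P.coroot k = P.coroot i + P.coroot j := by
  have hneg : P.flip.pairingIn ℤ j i < 0 := by
    have h1 := P.flip.algebraMap_pairingIn ℤ j i
    rw [P.pairing_flip, ← hP.inner_coroot] at h1
    rw [← h1] at h
    simpa using h
  obtain ⟨k, hk⟩ := P.flip.root_add_root_mem_of_pairingIn_neg (i := j) (j := i) hneg
    (fun h' => hne (by rw [eq_neg_iff_add_eq_zero, add_comm, ← eq_neg_iff_add_eq_zero]; exact h'))
  exact ⟨k, by rw [add_comm]; exact hk⟩

/-- Induction on the number of summands. A summand `α^∨` alone contributes 2 to the pairing with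
`α`, so the bound 1 forces another summand to pair negatively with `α`; the two cancel or merge into
one coroot. -/
lemma sum_coroot_eq_zero [Finite ι] [P.IsCrystallographic] (hP : IsEuclidean P)
    (m : Multiset ι) (hm : ∀ i ∈ m, P.root i ∈ rootSpanJ b J)
    (hle : ∀ i, P.root i ∈ rootSpanJ b J → ⟪(m.map P.coroot).sum, P.root i⟫_ℝ ≤ 1) :
    (m.map P.coroot).sum = 0 := by
  induction hn : m.card using Nat.strong_induction_on generalizing m with
  | _ n ih =>
    obtain rfl | ⟨i, hi⟩ := m.empty_or_exists_mem
    · simp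
    obtain ⟨m, rfl⟩ := Multiset.exists_cons_of_mem hi
    have hiJ := hm i hi
    obtain ⟨j, hj, hji⟩ : ∃ j ∈ m, ⟪P.coroot j, P.root i⟫_ℝ < 0 := by
      by_contra! hcon
      have h1 : 0 ≤ ⟪(m.map P.coroot).sum, P.root i⟫_ℝ := by
        clear hn hle hm hi
        induction m using Multiset.induction_on with
        | empty => simp
        | cons a m iha =>
          rw [Multiset.map_cons, Multiset.sum_cons, inner_add_left]
          exact add_nonneg (hcon a (by simp)) (iha fun k hk => hcon k (by simp [hk]))
      have h2 := hle i hiJ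
      rw [Multiset.map_cons, Multiset.sum_cons, inner_add_left, hP.inner_coroot_self] at h2
      linarith
    obtain ⟨m, rfl⟩ := Multiset.exists_cons_of_mem hj
    by_cases hne : P.coroot i = -P.coroot j
    · have hsum : (((i ::ₘ j ::ₘ m)).map P.coroot).sum = (m.map P.coroot).sum := by
        simp [hne]
      rw [hsum] at hle ⊢
      exact ih m.card (by simp at hn; omega) m (fun k hk => hm k (by simp [hk])) hle rfl
    · obtain ⟨k, hk⟩ := exists_coroot_add_eq hP hji hne
      have hsum : (((i ::ₘ j ::ₘ m)).map P.coroot).sum = ((k ::ₘ m).map P.coroot).sum := by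
        simp [hk, add_assoc]
      have hkJ : P.root k ∈ rootSpanJ b J := by
        rw [← coroot_mem_rootSpanJ_iff hP, hk]
        exact add_mem ((coroot_mem_rootSpanJ_iff hP).2 hiJ)
          ((coroot_mem_rootSpanJ_iff hP).2 (hm j (by simp)))
      rw [hsum] at hle ⊢
      refine ih (k ::ₘ m).card (by simp at hn ⊢; omega) (k ::ₘ m) (fun l hl => ?_) hle rfl
      rcases Multiset.mem_cons.1 hl with rfl | hl
      · exact hkJ
      · exact hm l (by simp [hl])

lemma exists_multiset_of_mem_corootLatticeJ {q : V}
    (hq : q ∈ corootLatticeJ b J) :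
    ∃ m : Multiset ι, (∀ i ∈ m, P.root i ∈ rootSpanJ b J) ∧ (m.map P.coroot).sum = q := by
  rw [corootLatticeJ, ← Submodule.mem_toAddSubgroup, Submodule.span_int_eq_addSubgroupClosure] at hq
  induction hq using AddSubgroup.closure_induction with
  | mem x hx =>
    obtain ⟨j, hj, rfl⟩ := hx
    exact ⟨{(j : ι)}, by simpa using root_mem_rootSpanJ hj, by simp⟩
  | zero => exact ⟨0, by simp, by simp⟩
  | add x y _ _ hx hy =>
    obtain ⟨m, hm, rfl⟩ := hx
    obtain ⟨m', hm', rfl⟩ := hy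
    refine ⟨m + m', fun i hi => ?_, by simp⟩
    exact (Multiset.mem_add.1 hi).elim (hm i) (hm' i)
  | neg x _ hx =>
    obtain ⟨m, hm, rfl⟩ := hx
    refine ⟨m.map fun i => P.reflectionPerm i i, fun i hi => ?_, ?_⟩
    · obtain ⟨j, hj, rfl⟩ := Multiset.mem_map.1 hi
      rw [root_reflectionPerm_self]
      exact neg_mem (hm j hj)
    · simp [Multiset.map_map]

/-- The action of `W_J ⋉ Q_J^∨` on the `J`-alcoves is free. -/
lemma eq_one_of_mem_fundAlcoveJ [Finite ι] [P.IsRootSystem] [P.IsCrystallographic] [P.IsReduced]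
    (hP : IsEuclidean P) {g : V ≃ᵃ[ℝ] V} (hg : g ∈ affineWeylGroupJ b J) {x : V}
    (hx : x ∈ fundAlcoveJ b J) (hgx : g x ∈ fundAlcoveJ b J) : g = 1 := by
  obtain ⟨σ, n, hσ⟩ := affineWeylGroupJ_le_parabolicGroup hP hg
  have h0 : ∀ i, ⟪g 0, P.root (σ i)⟫_ℝ = n i := fun i => by simpa using (hσ i).1 0
  have hq : g 0 ∈ corootLatticeJ b J := (apply_mem_corootLatticeJ_iff hP hg 0).2 (zero_mem _)
  have hoff : ∀ i, IsPosJ b J (σ i) → b.IsPos i ∧ n i = 0 ∨ ¬ b.IsPos i ∧ n i = 1 :=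
    fun i hi => offset_eq (hσ i).1 ((hσ i).2.1.1 hi.2) hi hx hgx
  -- Pairings with positive roots of `Φ_J` are offsets, hence 0 or 1; negative roots give 0 or -1.
  have hle : ∀ k, P.root k ∈ rootSpanJ b J → ⟪g 0, P.root k⟫_ℝ ≤ 1 := by
    intro k hk
    rcases isPosJ_or_isPosJ_neg hk with h | h
    · obtain ⟨i, rfl⟩ := σ.surjective k
      rcases hoff i h with h' | h' <;> simp [h0, h'.2]
    · obtain ⟨i, hi⟩ := σ.surjective (P.reflectionPerm k k)
      have h1 := h0 i
      rw [hi, root_reflectionPerm_self, inner_neg_right] at h1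
      rcases hoff i (hi ▸ h) with h' | h' <;> rw [h'.2] at h1 <;> push_cast at h1 <;> linarith
  have hg0 : g 0 = 0 := by
    obtain ⟨m, hm, hsum⟩ := exists_multiset_of_mem_corootLatticeJ hq
    rw [← hsum] at hle ⊢
    exact sum_coroot_eq_zero hP m hm hle
  have hn : ∀ i, n i = 0 := fun i => by
    have := h0 i
    rw [hg0, inner_zero_left] at this
    exact_mod_cast this.symm
  have hpos : ∀ i, b.IsPos (σ i) → b.IsPos i := by
    intro i hi
    by_cases hJ : P.root i ∈ rootSpanJ b J
    · have h := hoff i ⟨hi, (hσ i).2.1.2 hJ⟩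
      rw [hn i] at h
      simpa using h
    · exact ((hσ i).2.2 hJ).1 hi
  have happ : ∀ y, g y = g.linear y := fun y => by
    have := g.map_vadd 0 y
    simpa [hg0] using this
  obtain ⟨l, hl⟩ := exists_linear_eq_wordProd hg
  -- The reversed word represents the inverse of the linear part; `hpos` controls preimages under
  -- `σ`, so positivity of images of simple roots is available for the inverse.
  have hone : wordProd b l.reverse = 1 := by
    refine wordProd_eq_one hP _ fun j k hk => hpos k ?_
    have hroot : P.root (σ k) = P.root j := by
      refine ext_inner_left ℝ fun y => ?_
      obtain ⟨y, rfl⟩ := g.surjective y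
      rw [(hσ k).1, hn, hk, happ, hl, ← hP.inner_wordProd l y, ← wordProd_inv,
        ← LinearEquiv.mul_apply, mul_inv_cancel]
      simp
    rw [P.root.injective hroot]
    exact RootPairing.Base.isPos_of_mem_support j.2
  rw [← wordProd_inv, inv_eq_one] at hone
  ext y
  rw [happ, hl, hone]
  rfl

end AffineAlcoves

end

/-! ### Pseudo-translation of adjacent alcoves -/

open AffineAlcoves in
theorem mainTheorem11 {ι V : Type*} [Finite ι] [NormedAddCommGroup V] [InnerProductSpace ℝ V]
    (P : RootPairing ι ℝ V V) [P.IsRootSystem] [P.IsCrystallographic] [P.IsReduced]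
    [P.IsIrreducible] (hP : AffineAlcoves.IsEuclidean P) (b : P.Base) (J : Set b.support)
    (w u : V ≃ᵃ[ℝ] V)
    (hw : w ∈ AffineAlcoves.affineWeylGroup P) (hu : u ∈ AffineAlcoves.affineWeylGroup P)
    (hwJ : AffineAlcoves.MemJ b J w) (huJ : AffineAlcoves.MemJ b J u)
    (hadj : AffineAlcoves.Adjacent b w u) (α : P.corootSpan ℤ) :
    -- the pseudo-translates of `w` and `u` are well defined
    (∃! y, y ∈ AffineAlcoves.affineWeylGroupJ b J ∧
      AffineAlcoves.MemJ b J ((w.trans (AffineAlcoves.transl (α : V))).trans y)) ∧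
    (∃! y, y ∈ AffineAlcoves.affineWeylGroupJ b J ∧
      AffineAlcoves.MemJ b J ((u.trans (AffineAlcoves.transl (α : V))).trans y)) ∧
    -- they are again adjacent, and the sign of the crossing is the same
    AffineAlcoves.Adjacent b
      (AffineAlcoves.pseudoTranslate b J w (Submodule.Quotient.mk α))
      (AffineAlcoves.pseudoTranslate b J u (Submodule.Quotient.mk α)) ∧
    (AffineAlcoves.PositiveCrossing b w u ↔
      AffineAlcoves.PositiveCrossing b
        (AffineAlcoves.pseudoTranslate b J w (Submodule.Quotient.mk α))
        (AffineAlcoves.pseudoTranslate b J u (Submodule.Quotient.mk α))) := by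
  obtain ⟨x₀, hx₀⟩ : (fundAlcove b).Nonempty := fundAlcove_nonempty
  have hp : w x₀ ∈ fundAlcoveJ b J := hwJ ⟨x₀, hx₀, rfl⟩
  obtain ⟨y, hy, hyp⟩ : ∃ y ∈ affineWeylGroupJ b J, y (w x₀ + α) ∈ fundAlcoveJ b J := by
    refine exists_mem_fundAlcoveJ hP hp fun i hi n h => ?_
    obtain ⟨m, hm⟩ := hP.exists_int_inner α.2 i
    refine ne_int_of_mem_fundAlcoveJ hp hi (n - m) ?_
    rw [inner_add_left, hm] at h
    push_cast
    linarith
  have hg : y * transl (α : V) ∈ parabolicGroup b J :=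
    mul_mem (affineWeylGroupJ_le_parabolicGroup hP hy) (transl_mem_parabolicGroup hP α.2)
  have hgp : (y * transl (α : V)) (w x₀) ∈ fundAlcoveJ b J := by
    rw [← transl_apply] at hyp
    exact hyp
  -- Although `y` was found from a point of the alcove `w`, it works for every alcove in `𝒜_J`, in
  -- particular for `u`.
  have hmem : ∀ {v : V ≃ᵃ[ℝ] V}, MemJ b J v → MemJ b J ((v.trans (transl (α : V))).trans y) :=
    fun hv => (memJ_trans hg hv hp hgp :)
  have huniq : ∀ {v : V ≃ᵃ[ℝ] V}, MemJ b J v → ∀ y', (y' ∈ affineWeylGroupJ b J ∧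
      MemJ b J ((v.trans (transl (α : V))).trans y')) → y' = y := by
    rintro v hv y' ⟨hy', hvy'⟩
    have h1 : y (transl (α : V) (v x₀)) ∈ fundAlcoveJ b J := hmem hv ⟨x₀, hx₀, rfl⟩
    have h2 : y' (transl (α : V) (v x₀)) ∈ fundAlcoveJ b J := hvy' ⟨x₀, hx₀, rfl⟩
    refine mul_inv_eq_one.1 (eq_one_of_mem_fundAlcoveJ hP (mul_mem hy' (inv_mem hy)) h1 ?_)
    rwa [AffineEquiv.mul_def, AffineEquiv.trans_apply,
      show y⁻¹ (y (transl (α : V) (v x₀))) = transl (α : V) (v x₀) from y.symm_apply_apply _]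
  have hpt : ∀ {v : V ≃ᵃ[ℝ] V}, MemJ b J v →
      pseudoTranslate b J v (Submodule.Quotient.mk α) = v.trans (y * transl (α : V)) := by
    intro v hv
    obtain ⟨⟨y', hy', hz⟩, hzJ⟩ := Classical.epsilon_spec
      (p := fun z => (∃ y ∈ affineWeylGroupJ b J, z = (v.trans (transl (α : V))).trans y) ∧
        MemJ b J z) ⟨_, ⟨y, hy, rfl⟩, hmem hv⟩
    rw [hz] at hzJ
    rw [huniq hv y' ⟨hy', hzJ⟩] at hz
    exact hz
  refine ⟨⟨y, ⟨hy, hmem hwJ⟩, huniq hwJ⟩, ⟨y, ⟨hy, hmem huJ⟩, huniq huJ⟩, ?_, ?_⟩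
  · rw [hpt hwJ, hpt huJ]
    exact adjacent_trans hadj _
  · rw [hpt hwJ, hpt huJ]
    refine ⟨positiveCrossing_trans ⟨x₀, hx₀⟩ hg hwJ huJ, fun h => ?_⟩
    have h' := positiveCrossing_trans (w := w.trans (y * transl (α : V)))
      (u := u.trans (y * transl (α : V))) ⟨x₀, hx₀⟩ (inv_mem hg) (hmem hwJ) (hmem huJ) h
    have hcancel : ∀ v : V ≃ᵃ[ℝ] V,
        (v.trans (y * transl (α : V))).trans (y * transl (α : V))⁻¹ = v := fun v =>
      inv_mul_cancel_left (y * transl (α : V)) v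
    rwa [hcancel, hcancel] at h'
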